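/- Let $B_0, B_1, B_2, \dots$ be the Bernoulli numbers, defined by $\frac{t}{e^t-1}=\sum_{n\ge 0}B_n\frac{t^n}{n!}$. Then for every integer $m\ge 0$, $$\sum_{\lambda\vdash m}\ \prod_{i=1}^{m}\frac{(-1)^{y_i}}{y_i!}\left(\frac{B_{2i}}{(2i)\,(2i)!}\right)^{y_i}=\left(\frac{1}{2^{2m-1}}-1\right)\frac{B_{2m}}{(2m)!},$$ where the sum runs over all partitions $\lambda$ of $m$ and $y_i=y_i(\lambda)$ denotes the number of parts of $\lambda$ equal to $i$ (so that $\sum_{i=1}^m i\,y_i=m$). -/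

import Mathlib

/-!
Both sides of the identity, as functions of `m`, take the value `1` at `m = 0` and satisfy the
same recurrence `m * a m = ∑_{i + j = m} i * x i * a j` with `x i = -B_{2i} / (2i (2i)!)`; such a
sequence is unique.

For the left-hand side the recurrence holds for arbitrary weights `x`: the sum is the `m`-th
coefficient of `exp (∑ x i T ^ i)`. Combinatorially, one writes `m = ∑ i * y_i` in every term and
removes one part equal to `i` (`mul_partitionSum`).

For the right-hand side, `(2 ^ (1 - n) - 1) B_n / n!` is the `n`-th coefficient of the power series
`G = t e^{t/2} / (e^t - 1) = (t/2) / sinh (t/2)`. Its logarithmic derivative satisfies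
`t G' = G (1 - t/2 - t / (e^t - 1))` (`X_mul_derivative_halfBernoulliSeries`). Here `G` and
`1 - t/2 - t / (e^t - 1) = -∑_{i ≥ 1} B_{2i} t ^ (2i) / (2i)!` are both even, and comparing the
coefficients of `t ^ (2m)` gives the recurrence.
-/

/-! ### Weighted sums over partitions -/

/-- The weight `∏ i, x i ^ y_i / y_i!` of a multiset in which `i` occurs `y_i` times. -/
def multisetWeight (x : ℕ → ℚ) (s : Multiset ℕ) : ℚ :=
  ∏ i ∈ s.toFinset, x i ^ s.count i / ((s.count i).factorial : ℚ)

theorem multisetWeight_eq_prod (x : ℕ → ℚ) (s : Multiset ℕ) {t : Finset ℕ}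
    (h : s.toFinset ⊆ t) :
    multisetWeight x s = ∏ i ∈ t, x i ^ s.count i / ((s.count i).factorial : ℚ) := by
  refine Finset.prod_subset h fun i _ hi => ?_
  simp [Multiset.count_eq_zero_of_notMem (fun hm => hi (Multiset.mem_toFinset.2 hm))]

theorem count_mul_multisetWeight_cons (x : ℕ → ℚ) (a : ℕ) (s : Multiset ℕ) :
    ((a ::ₘ s).count a : ℚ) * multisetWeight x (a ::ₘ s) = x a * multisetWeight x s := by
  have hs : s.toFinset ⊆ (a ::ₘ s).toFinset := by simp
  have ha : a ∈ (a ::ₘ s).toFinset := by simp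
  rw [multisetWeight_eq_prod x s hs, multisetWeight, ← Finset.mul_prod_erase _ _ ha,
    ← Finset.mul_prod_erase _ _ ha]
  have hrest : ∏ i ∈ (a ::ₘ s).toFinset.erase a,
        x i ^ (a ::ₘ s).count i / (((a ::ₘ s).count i).factorial : ℚ)
      = ∏ i ∈ (a ::ₘ s).toFinset.erase a, x i ^ s.count i / ((s.count i).factorial : ℚ) := by
    refine Finset.prod_congr rfl fun i hi => ?_
    rw [Multiset.count_cons_of_ne (Finset.ne_of_mem_erase hi)]
  rw [hrest, Multiset.count_cons_self, Nat.factorial_succ, pow_succ]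
  have h1 : ((s.count a).factorial : ℚ) ≠ 0 := by positivity
  have h2 : ((s.count a : ℚ) + 1) ≠ 0 := by positivity
  push_cast
  field_simp

/-- The sum of the weights of all partitions of `n`, that is, the coefficient of `T ^ n` in
`exp (∑ x i T ^ i)`. -/
def partitionSum (x : ℕ → ℚ) (n : ℕ) : ℚ :=
  ∑ P : Nat.Partition n, multisetWeight x P.parts

theorem partitionSum_zero (x : ℕ → ℚ) : partitionSum x 0 = 1 := by
  simp [partitionSum, multisetWeight]

/-- Removing one part equal to `a` is a bijection from the partitions of `n` that contain `a` to
the partitions of `n - a`. -/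
theorem sum_count_mul_multisetWeight (x : ℕ → ℚ) {n a : ℕ} (ha1 : 1 ≤ a) (ha : a ≤ n) :
    ∑ P : Nat.Partition n, (P.parts.count a : ℚ) * multisetWeight x P.parts
      = x a * partitionSum x (n - a) := by
  rw [partitionSum, Finset.mul_sum]
  symm
  refine Finset.sum_of_injOn
    (fun Q => ((Nat.Partition.partitionWithPartEquiv ha1 ha).symm Q).1) ?_ ?_ ?_ ?_
  · intro Q _ R _ h
    exact (Nat.Partition.partitionWithPartEquiv ha1 ha).symm.injective (Subtype.ext h)
  · simp [Set.MapsTo]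
  · intro P _ hP
    have : a ∉ P.parts := fun h => hP
      ⟨Nat.Partition.partitionWithPartEquiv ha1 ha ⟨P, h⟩, by simp, by simp⟩
    simp [Multiset.count_eq_zero_of_notMem this]
  · intro Q _
    rw [Nat.Partition.partitionWithPartEquiv_symm_apply_parts, count_mul_multisetWeight_cons]

theorem mul_partitionSum (x : ℕ → ℚ) (n : ℕ) :
    (n : ℚ) * partitionSum x n
      = ∑ p ∈ Finset.HasAntidiagonal.antidiagonal n, (p.1 : ℚ) * x p.1 * partitionSum x p.2 := by
  have hn : ∀ P : Nat.Partition n, (n : ℚ) = ∑ i ∈ Finset.range (n + 1),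
      (i : ℚ) * P.parts.count i := by
    intro P
    have hsub : P.parts.toFinset ⊆ Finset.range (n + 1) := fun i hi =>
      Finset.mem_range_succ_iff.2 (P.le_of_mem_parts (Multiset.mem_toFinset.1 hi))
    have h := Finset.sum_multiset_count_of_subset P.parts _ hsub
    rw [P.parts_sum] at h
    conv_lhs => rw [h]
    push_cast [smul_eq_mul]
    exact Finset.sum_congr rfl fun i _ => mul_comm _ _
  rw [Finset.Nat.sum_antidiagonal_eq_sum_range_succ
    (fun i j => (i : ℚ) * x i * partitionSum x j)]
  calc (n : ℚ) * partitionSum x n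
      = ∑ P : Nat.Partition n, ∑ i ∈ Finset.range (n + 1),
          (i : ℚ) * ((P.parts.count i : ℚ) * multisetWeight x P.parts) := by
        rw [partitionSum, Finset.mul_sum]
        refine Finset.sum_congr rfl fun P _ => ?_
        conv_lhs => rw [hn P, Finset.sum_mul]
        exact Finset.sum_congr rfl fun i _ => mul_assoc _ _ _
    _ = ∑ i ∈ Finset.range (n + 1), (i : ℚ) * x i * partitionSum x (n - i) := by
        rw [Finset.sum_comm]
        refine Finset.sum_congr rfl fun i hi => ?_
        rcases Nat.eq_zero_or_pos i with rfl | hpos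
        · simp
        · rw [← Finset.mul_sum, sum_count_mul_multisetWeight x hpos
            (Finset.mem_range_succ_iff.1 hi), mul_assoc]

/-- The term `i = 0` of the recurrence vanishes, so that it determines `a` from `a 0`. -/
theorem eq_of_mul_eq_sum_antidiagonal {x a b : ℕ → ℚ} (h0 : a 0 = b 0)
    (ha : ∀ n : ℕ, (n : ℚ) * a n =
      ∑ p ∈ Finset.HasAntidiagonal.antidiagonal n, (p.1 : ℚ) * x p.1 * a p.2)
    (hb : ∀ n : ℕ, (n : ℚ) * b n =
      ∑ p ∈ Finset.HasAntidiagonal.antidiagonal n, (p.1 : ℚ) * x p.1 * b p.2)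
    (n : ℕ) : a n = b n := by
  induction n using Nat.strong_induction_on with
  | _ n ih =>
    rcases Nat.eq_zero_or_pos n with rfl | hpos
    · exact h0
    · have hn : (n : ℚ) ≠ 0 := by positivity
      refine mul_left_cancel₀ hn ?_
      rw [ha, hb]
      refine Finset.sum_congr rfl fun p hp => ?_
      rw [Finset.HasAntidiagonal.mem_antidiagonal] at hp
      rcases Nat.eq_zero_or_pos p.1 with h | h
      · simp [h]
      · rw [ih p.2 (by omega)]

/-! ### The power series of `(t/2) / sinh (t/2)` -/

open PowerSeries in
/-- The power series `2 B(t/2) - B(t)` with `B(t) = t / (e^t - 1)`; it is equal to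
`t e^{t/2} / (e^t - 1)`. -/
noncomputable def halfBernoulliSeries : PowerSeries ℚ :=
  2 * rescale (1 / 2 : ℚ) (bernoulliPowerSeries ℚ) - bernoulliPowerSeries ℚ

open PowerSeries in
theorem coeff_halfBernoulliSeries (n : ℕ) :
    coeff n halfBernoulliSeries
      = (2 * (1 / 2 : ℚ) ^ n - 1) * (bernoulli n / (n.factorial : ℚ)) := by
  have h2 : (2 : PowerSeries ℚ) = C (2 : ℚ) := (map_ofNat C 2).symm
  rw [halfBernoulliSeries, h2, map_sub, coeff_C_mul, coeff_rescale]
  simp only [bernoulliPowerSeries, coeff_mk, Algebra.algebraMap_self, RingHom.id_apply]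
  ring

open PowerSeries in
theorem coeff_halfBernoulliSeries_of_odd {n : ℕ} (hn : Odd n) :
    coeff n halfBernoulliSeries = 0 := by
  rw [coeff_halfBernoulliSeries]
  rcases eq_or_ne n 1 with rfl | h1
  · norm_num
  · rw [bernoulli_eq_zero_of_odd hn (by have := hn.pos; omega)]
    simp

open PowerSeries in
theorem rescale_half_exp_mul_self :
    rescale (1 / 2 : ℚ) (exp ℚ) * rescale (1 / 2 : ℚ) (exp ℚ) = exp ℚ := by
  rw [exp_mul_exp_eq_exp_add]
  norm_num

open PowerSeries in
theorem exp_sub_one_ne_zero : (exp ℚ - 1 : PowerSeries ℚ) ≠ 0 := by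
  intro h
  have := bernoulliPowerSeries_mul_exp_sub_one ℚ
  rw [h, mul_zero] at this
  exact X_ne_zero this.symm

open PowerSeries in
theorem halfBernoulliSeries_mul_exp_sub_one :
    halfBernoulliSeries * (exp ℚ - 1) = X * rescale (1 / 2 : ℚ) (exp ℚ) := by
  have hB := bernoulliPowerSeries_mul_exp_sub_one ℚ
  have hR := congrArg (rescale (1 / 2 : ℚ)) hB
  rw [map_mul, map_sub, map_one, rescale_X] at hR
  have hC : (2 : PowerSeries ℚ) * C (1 / 2 : ℚ) = 1 := by
    rw [show (2 : PowerSeries ℚ) = C (2 : ℚ) from (map_ofNat C 2).symm, ← map_mul]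
    norm_num
  have hH := rescale_half_exp_mul_self
  rw [halfBernoulliSeries]
  -- with `h = e^{t/2}` one has `e^t - 1 = (h - 1) (h + 1)` and `B(t/2) (h - 1) = t/2`
  linear_combination (2 * (rescale (1 / 2 : ℚ) (exp ℚ) + 1)) * hR - hB
    + X * (rescale (1 / 2 : ℚ) (exp ℚ) + 1) * hC
    - 2 * rescale (1 / 2 : ℚ) (bernoulliPowerSeries ℚ) * hH

open PowerSeries in
theorem derivative_rescale_half_exp :
    d⁄dX ℚ (rescale (1 / 2 : ℚ) (exp ℚ)) = C (1 / 2 : ℚ) * rescale (1 / 2 : ℚ) (exp ℚ) := by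
  ext n
  rw [coeff_derivative, coeff_C_mul, coeff_rescale, coeff_rescale, coeff_exp, coeff_exp,
    Nat.factorial_succ, pow_succ]
  simp only [Algebra.algebraMap_self, RingHom.id_apply]
  have h1 : (n.factorial : ℚ) ≠ 0 := by positivity
  have h2 : (n : ℚ) + 1 ≠ 0 := by positivity
  push_cast
  field_simp

open PowerSeries in
theorem X_mul_derivative_halfBernoulliSeries :
    X * d⁄dX ℚ halfBernoulliSeries
      = (1 - C (1 / 2 : ℚ) * X - bernoulliPowerSeries ℚ) * halfBernoulliSeries := by
  have hB := bernoulliPowerSeries_mul_exp_sub_one ℚ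
  have hG := halfBernoulliSeries_mul_exp_sub_one
  have hD := congrArg (d⁄dX ℚ) hG
  simp only [Derivation.leibniz, map_sub, derivative_exp, derivative_one, derivative_X,
    derivative_rescale_half_exp, smul_eq_mul, sub_zero, mul_one] at hD
  have hC : (2 : PowerSeries ℚ) * C (1 / 2 : ℚ) = 1 := by
    rw [show (2 : PowerSeries ℚ) = C (2 : ℚ) from (map_ofNat C 2).symm, ← map_mul]
    norm_num
  refine mul_right_cancel₀ exp_sub_one_ne_zero ?_
  -- `X` times the differentiated identity, with `X * e^t` rewritten by means of `X = B (e^t - 1)`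
  linear_combination X * hD - (1 + C (1 / 2 : ℚ) * X) * hG
    + X * halfBernoulliSeries * (exp ℚ - 1) * hC + halfBernoulliSeries * hB

open PowerSeries in
theorem coeff_two_mul_mul_of_odd_coeff_eq_zero {f g : PowerSeries ℚ}
    (hg : ∀ n, Odd n → coeff n g = 0) (m : ℕ) :
    coeff (2 * m) (f * g)
      = ∑ p ∈ Finset.HasAntidiagonal.antidiagonal m, coeff (2 * p.1) f * coeff (2 * p.2) g := by
  rw [coeff_mul]
  symm
  refine Finset.sum_of_injOn (fun p => (2 * p.1, 2 * p.2)) ?_ ?_ ?_ ?_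
  · rintro ⟨a, b⟩ _ ⟨c, d⟩ _ h
    simp only [Prod.mk.injEq] at h ⊢
    omega
  · rintro ⟨a, b⟩ h
    simp only [Finset.mem_coe, Finset.HasAntidiagonal.mem_antidiagonal] at h ⊢
    omega
  · rintro ⟨a, b⟩ h hn
    rw [Finset.HasAntidiagonal.mem_antidiagonal] at h
    rcases Nat.even_or_odd b with hb | hb
    · obtain ⟨d, rfl⟩ := hb
      refine absurd ⟨(m - d, d), ?_, ?_⟩ hn
      · simp only [Finset.mem_coe, Finset.HasAntidiagonal.mem_antidiagonal]
        omega
      · simp only [Prod.mk.injEq]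
        omega
    · simp [hg b hb]
  · intro p _
    rfl

open PowerSeries in
theorem mul_coeff_halfBernoulliSeries (m : ℕ) :
    (m : ℚ) * coeff (2 * m) halfBernoulliSeries
      = ∑ p ∈ Finset.HasAntidiagonal.antidiagonal m,
          (p.1 : ℚ) * -(bernoulli (2 * p.1) / ((2 * (p.1 : ℚ)) * ((2 * p.1).factorial : ℚ)))
            * coeff (2 * p.2) halfBernoulliSeries := by
  have h := congrArg (coeff (2 * m)) X_mul_derivative_halfBernoulliSeries
  rw [coeff_two_mul_mul_of_odd_coeff_eq_zero fun n => coeff_halfBernoulliSeries_of_odd] at h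
  have hl : coeff (2 * m) (X * d⁄dX ℚ halfBernoulliSeries)
      = 2 * ((m : ℚ) * coeff (2 * m) halfBernoulliSeries) := by
    rcases m with _ | k
    · simp
    · rw [show 2 * (k + 1) = (2 * k + 1) + 1 by ring, coeff_succ_X_mul, coeff_derivative]
      push_cast
      ring
  refine mul_left_cancel₀ (two_ne_zero (α := ℚ)) ?_
  rw [← hl, h, Finset.mul_sum]
  refine Finset.sum_congr rfl fun p _ => ?_
  rw [← mul_assoc]
  congr 1
  rcases p.1 with _ | i
  · simp [bernoulliPowerSeries]
  · rw [map_sub, map_sub, coeff_C_mul, coeff_one, coeff_X, if_neg (by omega), if_neg (by omega)]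
    simp only [bernoulliPowerSeries, coeff_mk, Algebra.algebraMap_self, RingHom.id_apply]
    have h1 : ((2 * (i + 1)).factorial : ℚ) ≠ 0 := by positivity
    have h2 : ((i + 1 : ℕ) : ℚ) ≠ 0 := by positivity
    field_simp
    ring

/-! ### The identity -/

theorem mainTheorem11 (m : ℕ) :
    ∑ P : Nat.Partition m, ∏ i ∈ Finset.Icc 1 m,
        ((-1 : ℚ) ^ P.parts.count i / ((P.parts.count i).factorial : ℚ)) *
          (bernoulli (2 * i) / ((2 * (i : ℚ)) * ((2 * i).factorial : ℚ))) ^ P.parts.count i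
      = (1 / (2 : ℚ) ^ (2 * (m : ℤ) - 1) - 1) * (bernoulli (2 * m) / ((2 * m).factorial : ℚ)) := by
  have key : partitionSum
      (fun i => -(bernoulli (2 * i) / ((2 * (i : ℚ)) * ((2 * i).factorial : ℚ)))) m
        = PowerSeries.coeff (2 * m) halfBernoulliSeries := by
    refine eq_of_mul_eq_sum_antidiagonal
      (b := fun m => PowerSeries.coeff (2 * m) halfBernoulliSeries) ?_
      (mul_partitionSum _) mul_coeff_halfBernoulliSeries m
    rw [partitionSum_zero, coeff_halfBernoulliSeries]
    norm_num
  have hpow : 1 / (2 : ℚ) ^ (2 * (m : ℤ) - 1) = 2 * (1 / 2 : ℚ) ^ (2 * m) := by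
    rw [zpow_sub_one₀ two_ne_zero, show 2 * (m : ℤ) = ((2 * m : ℕ) : ℤ) by push_cast; rfl,
      zpow_natCast, one_div_pow]
    field_simp
  rw [hpow, ← coeff_halfBernoulliSeries, ← key, partitionSum]
  refine Finset.sum_congr rfl fun P _ => ?_
  have hsub : P.parts.toFinset ⊆ Finset.Icc 1 m := fun i hi => by
    rw [Multiset.mem_toFinset] at hi
    exact Finset.mem_Icc.2 ⟨P.parts_pos hi, P.le_of_mem_parts hi⟩
  rw [multisetWeight_eq_prod _ _ hsub]
  refine Finset.prod_congr rfl fun i _ => ?_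
  generalize bernoulli (2 * i) / ((2 * (i : ℚ)) * ((2 * i).factorial : ℚ)) = c
  rw [neg_pow c]
  ring
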